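/- Let $(\Omega,\mathcal F)$ be a measurable space, $\mathcal P$ a non-empty set of probability measures on it, and $c(A)=\sup_{P\in\mathcal P}P(A)$ for $A\in\mathcal F$. An event $A$ is $\mathcal P$-polar if $c(A)=0$; a property holds quasi surely (q.s.) if it holds outside a polar event. Let $L^0_c$ be the vector lattice of measurable functions $\Omega\to\mathbb R$ modulo q.s. equality, with the order $X\preccurlyeq Y$ iff $X\le Y$ q.s.; let $L^0_{c+}=\{X\in L^0_c: 0\preccurlyeq X\}$ and $L^\infty_c=\{X\in L^0_c:\exists m>0,\ |X|\preccurlyeq m\}$. Let $ca_c$ be the space of finite signed measures $\mu$ on $\mathcal F$ whose total variation $|\mu|$ vanishes on all polar events, and $\mathfrak P_c(\Omega)$ the set of probability measures in $ca_c$. A measure $\mu\in ca_c$ is supported if there is $S\in\mathcal F$ with $|\mu|(S^c)=0$ such that, for all $N\in\mathcal F$, $|\mu|(N\cap S)=0$ implies that $N\cap S$ is polar; $sca_c$ is the set of supported $\mu\in ca_c$. The set $\mathcal P$ is of class (S) if there is a non-empty set $\mathcal Q\subset\mathfrak P_c(\Omega)\cap sca_c$ such that every $N\in\mathcal F$ with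 $\sup_{Q\in\mathcal Q}Q(N)=0$ is $\mathcal P$-polar. For $Q\in\mathfrak P_c(\Omega)$ let $L^0_Q$ be the space of measurable functions $\Omega\to\mathbb R$ modulo $Q$-a.s. equality and let $j_Q:L^0_c\to L^0_Q$ map the q.s. class of a function to its $Q$-a.s. class. A set $\mathcal C\subset L^0_c$ is $\mathcal P$-sensitive if $\mathcal C=\bigcap_{Q\in\mathfrak P_c(\Omega)}j_Q^{-1}(j_Q(\mathcal C))$. A set $\mathcal Q\subset\mathfrak P_c(\Omega)$ is a reduction set for $\mathcal C$ if $\mathcal Q\ne\emptyset$ and $\mathcal C=\bigcap_{Q\in\mathcal Q}j_Q^{-1}(j_Q(\mathcal C))$. The set $\mathcal C$ is solid if either ($X\in\mathcal C$, $Y\in L^0_c$, $|Y|\preccurlyeq|X|$ imply $Y\in\mathcal C$), or ($\mathcal C\subset L^0_{c+}$, and $X\in\mathcal C$, $Y\in L^0_{c+}$, $Y\preccurlyeq X$ imply $Y\in\mathcal C$). A net $(X_\alpha)_{\alpha\in I}$ in $L^0_c$ is order convergent to $X\in L^0_c$ if there is a decreasing net $(Y_\alpha)_{\alpha\in I}$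 in $L^0_c$ with $\inf_\alpha Y_\alpha=0$ and $|X_\alpha-X|\preccurlyeq Y_\alpha$ for all $\alpha\in I$; $\mathcal C$ is order closed if it contains the limits of all order convergent nets in $\mathcal C$. Suppose that $\mathcal P$ is of class (S), and let $\mathcal Y\subset sca_c$ be a linear subspace such that $|\mu|\in\mathcal Y$ for all $\mu\in\mathcal Y$ and such that for all $X\ne Z$ in $L^\infty_c$ there is $\mu\in\mathcal Y$ with $\int X\,d\mu\ne\int Z\,d\mu$. Then every convex, solid, order closed set $\mathcal C\subset L^0_c$ is $\mathcal P$-sensitive, and $\mathfrak P_c(\Omega)\cap\mathcal Y$ is a reduction set for $\mathcal C$. -/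

import Mathlib

open MeasureTheory

namespace QuasiSure

universe u

variable {Ω : Type u} [MeasurableSpace Ω]

section Basics

/-- The upper probability `c(A) = sup_{P ∈ 𝓟} P(A)` of a set of probability measures. -/
noncomputable def upperProb (𝓟 : Set (ProbabilityMeasure Ω)) (A : Set Ω) : ENNReal :=
  ⨆ P ∈ 𝓟, (P : Measure Ω) A

/-- `A` is `𝓟`-polar: `c(A) = 0`. It is only applied to measurable sets `A`. -/
def IsPolar (𝓟 : Set (ProbabilityMeasure Ω)) (A : Set Ω) : Prop :=
  upperProb 𝓟 A = 0

theorem isPolar_iff {𝓟 : Set (ProbabilityMeasure Ω)} {A : Set Ω} :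
    IsPolar 𝓟 A ↔ ∀ P ∈ 𝓟, (P : Measure Ω) A = 0 := by
  simp [IsPolar, upperProb]

theorem IsPolar.mono {𝓟 : Set (ProbabilityMeasure Ω)} {A B : Set Ω} (hB : IsPolar 𝓟 B)
    (h : A ⊆ B) : IsPolar 𝓟 A :=
  isPolar_iff.2 fun P hP => measure_mono_null h (isPolar_iff.1 hB P hP)

theorem IsPolar.union {𝓟 : Set (ProbabilityMeasure Ω)} {A B : Set Ω} (hA : IsPolar 𝓟 A)
    (hB : IsPolar 𝓟 B) : IsPolar 𝓟 (A ∪ B) :=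
  isPolar_iff.2 fun P hP => measure_union_null (isPolar_iff.1 hA P hP) (isPolar_iff.1 hB P hP)

theorem isPolar_empty (𝓟 : Set (ProbabilityMeasure Ω)) : IsPolar 𝓟 ∅ :=
  isPolar_iff.2 fun _ _ => measure_empty

/-- A (finite) measure `μ` is dominated by `𝓟`: `μ ≪ 𝓟`. -/
def MeasureDominated (μ : Measure Ω) (𝓟 : Set (ProbabilityMeasure Ω)) : Prop :=
  ∀ N : Set Ω, MeasurableSet N → IsPolar 𝓟 N → μ N = 0

/-- `𝓠 ≪ 𝓟` for sets of probability measures. -/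
def SetDominated (𝓠 𝓟 : Set (ProbabilityMeasure Ω)) : Prop :=
  ∀ N : Set Ω, MeasurableSet N → IsPolar 𝓟 N → IsPolar 𝓠 N

/-- `𝓠 ≈ 𝓟` for sets of probability measures. -/
def SetEquivalent (𝓠 𝓟 : Set (ProbabilityMeasure Ω)) : Prop :=
  SetDominated 𝓠 𝓟 ∧ SetDominated 𝓟 𝓠

/-- The set `𝔓_c(Ω)` of all probability measures that are dominated by `𝓟`. -/
def domProb (𝓟 : Set (ProbabilityMeasure Ω)) : Set (ProbabilityMeasure Ω) :=
  {Q | MeasureDominated (Q : Measure Ω) 𝓟}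

/-- The space `ca_c` of all finite signed measures that are dominated by `𝓟`
(`totalVariation` is Mathlib's total variation measure `|μ|`). -/
def ca (𝓟 : Set (ProbabilityMeasure Ω)) : Set (SignedMeasure Ω) :=
  {μ | MeasureDominated μ.totalVariation 𝓟}

/-- A measure `μ` is supported (relative to the `𝓟`-polar sets). -/
def IsSupported (𝓟 : Set (ProbabilityMeasure Ω)) (μ : Measure Ω) : Prop :=
  ∃ S : Set Ω, MeasurableSet S ∧ μ Sᶜ = 0 ∧
    ∀ N : Set Ω, MeasurableSet N → μ (N ∩ S) = 0 → IsPolar 𝓟 (N ∩ S)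

/-- The space `sca_c` of all supported signed measures in `ca_c`. -/
def sca (𝓟 : Set (ProbabilityMeasure Ω)) : Set (SignedMeasure Ω) :=
  {μ | μ ∈ ca 𝓟 ∧ IsSupported 𝓟 μ.totalVariation}

/-- `𝓟` is of class (S): it is equivalent to a non-empty set of supported probability measures. -/
def IsClassS (𝓟 : Set (ProbabilityMeasure Ω)) : Prop :=
  ∃ 𝓠 : Set (ProbabilityMeasure Ω), 𝓠.Nonempty ∧
    (∀ Q ∈ 𝓠, Q ∈ domProb 𝓟 ∧ IsSupported 𝓟 (Q : Measure Ω)) ∧ SetEquivalent 𝓠 𝓟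

end Basics

section QuotientSpace

variable (Ω) in
/-- The vector space `𝓛⁰` of all real-valued measurable functions on `Ω`. -/
def MeasFun : Submodule ℝ (Ω → ℝ) where
  carrier := {f | Measurable f}
  zero_mem' := measurable_const
  add_mem' hf hg := Measurable.add hf hg
  smul_mem' c _ hf := Measurable.const_smul hf c

/-- The subspace `𝒩 = {f ∈ 𝓛⁰ | c(|f| > 0) = 0}`. -/
def nullFun (𝓟 : Set (ProbabilityMeasure Ω)) : Submodule ℝ (MeasFun Ω) where
  carrier := {f | IsPolar 𝓟 {ω | 0 < |f.1 ω|}}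
  zero_mem' := (isPolar_empty 𝓟).mono fun ω hω => by simp at hω
  add_mem' {f g} hf hg := (IsPolar.union hf hg).mono fun ω hω => by
    by_contra hc
    simp only [Set.mem_union, Set.mem_ofPred_eq, abs_pos, not_or, not_not] at hc
    simp [hc.1, hc.2] at hω
  smul_mem' c f hf := IsPolar.mono hf fun ω hω => by
    simp only [Set.mem_ofPred_eq, abs_pos] at hω ⊢
    intro h0
    exact hω (by simp [h0])

/-- The quotient space `L⁰_c = 𝓛⁰ / 𝒩`. -/
abbrev L0 (𝓟 : Set (ProbabilityMeasure Ω)) : Type u := MeasFun Ω ⧸ nullFun 𝓟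

variable {𝓟 : Set (ProbabilityMeasure Ω)}

/-- The class `[f]_c` of `f ∈ 𝓛⁰`. -/
def mk (𝓟 : Set (ProbabilityMeasure Ω)) (f : MeasFun Ω) : L0 𝓟 := Submodule.Quotient.mk f

theorem mk_eq_iff {f g : MeasFun Ω} : mk 𝓟 f = mk 𝓟 g ↔ IsPolar 𝓟 {ω | f.1 ω ≠ g.1 ω} := by
  have h : {ω | 0 < |(f - g).1 ω|} = {ω | f.1 ω ≠ g.1 ω} := by
    ext ω
    simp [sub_eq_zero]
  rw [← h]
  exact Submodule.Quotient.eq (nullFun 𝓟)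

theorem mk_surjective (X : L0 𝓟) : ∃ f : MeasFun Ω, mk 𝓟 f = X :=
  Submodule.Quotient.mk_surjective (nullFun 𝓟) X

/-- A representative of `X`. -/
noncomputable def rep (X : L0 𝓟) : MeasFun Ω := (mk_surjective X).choose

theorem mk_rep (X : L0 𝓟) : mk 𝓟 (rep X) = X := (mk_surjective X).choose_spec

/-- The `𝓟`-quasi-sure order: `X ≼ Y` if `f ≤ g` `𝓟`-q.s. for `f ∈ X` and `g ∈ Y`. -/
instance : LE (L0 𝓟) where
  le X Y := ∃ f g : MeasFun Ω, mk 𝓟 f = X ∧ mk 𝓟 g = Y ∧ IsPolar 𝓟 {ω | g.1 ω < f.1 ω}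

theorem mk_le_mk {f g : MeasFun Ω} :
    mk 𝓟 f ≤ mk 𝓟 g ↔ IsPolar 𝓟 {ω | g.1 ω < f.1 ω} := by
  refine ⟨?_, fun h => ⟨f, g, rfl, rfl, h⟩⟩
  rintro ⟨f', g', hf, hg, h⟩
  refine (((mk_eq_iff.1 hf).union (mk_eq_iff.1 hg)).union h).mono fun ω hω => ?_
  by_contra hc
  simp only [Set.mem_union, Set.mem_ofPred_eq, not_or, not_not, not_lt] at hc hω
  linarith [hc.1.1, hc.1.2, hc.2]

instance : PartialOrder (L0 𝓟) where
  le_refl X := by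
    obtain ⟨f, rfl⟩ := mk_surjective X
    exact mk_le_mk.2 ((isPolar_empty 𝓟).mono fun ω hω => by simp at hω)
  le_trans X Y Z hXY hYZ := by
    obtain ⟨f, rfl⟩ := mk_surjective X
    obtain ⟨g, rfl⟩ := mk_surjective Y
    obtain ⟨h, rfl⟩ := mk_surjective Z
    refine mk_le_mk.2 (((mk_le_mk.1 hXY).union (mk_le_mk.1 hYZ)).mono fun ω hω => ?_)
    by_contra hc
    simp only [Set.mem_union, Set.mem_ofPred_eq, not_or, not_lt] at hc hω
    linarith [hc.1, hc.2]
  le_antisymm X Y hXY hYX := by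
    obtain ⟨f, rfl⟩ := mk_surjective X
    obtain ⟨g, rfl⟩ := mk_surjective Y
    refine mk_eq_iff.2 (((mk_le_mk.1 hXY).union (mk_le_mk.1 hYX)).mono fun ω hω => ?_)
    by_contra hc
    simp only [Set.mem_union, Set.mem_ofPred_eq, not_or, not_lt] at hc hω
    exact hω (le_antisymm hc.1 hc.2)

/-- The pointwise absolute value of a measurable function. -/
def absFun (f : MeasFun Ω) : MeasFun Ω := ⟨fun ω => |f.1 ω|, by
  have hf : Measurable f.1 := f.2
  change Measurable fun ω => |f.1 ω|
  fun_prop⟩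

/-- The absolute value `|X| = [|f|]_c`, `f ∈ X`. -/
noncomputable def absL0 (X : L0 𝓟) : L0 𝓟 := mk 𝓟 (absFun (rep X))

theorem absL0_mk (f : MeasFun Ω) : absL0 (mk 𝓟 f) = mk 𝓟 (absFun f) :=
  mk_eq_iff.2 ((mk_eq_iff.1 (mk_rep (mk 𝓟 f))).mono fun ω hω h => hω (by
    simp [absFun, h]))

/-- The constant function `m`. -/
def constFun (m : ℝ) : MeasFun Ω := ⟨fun _ => m, measurable_const⟩

/-- The space `L^∞_c` of `𝓟`-q.s. bounded elements of `L⁰_c`. -/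
def Linfty (𝓟 : Set (ProbabilityMeasure Ω)) : Set (L0 𝓟) :=
  {X | ∃ m : ℝ, 0 < m ∧ absL0 X ≤ mk 𝓟 (constFun m)}

/-- The integral of a function with respect to a finite signed measure. -/
noncomputable def signedIntegral (μ : SignedMeasure Ω) (f : Ω → ℝ) : ℝ :=
  (∫ ω, f ω ∂μ.toJordanDecomposition.posPart) - ∫ ω, f ω ∂μ.toJordanDecomposition.negPart

/-- The integral `∫ X dμ` of a class `X`; it is meant for `X ∈ L^∞_c` and `μ ∈ ca_c`. -/
noncomputable def integralL0 (X : L0 𝓟) (μ : SignedMeasure Ω) : ℝ :=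
  signedIntegral μ (rep X).1

theorem integralL0_mk {μ : SignedMeasure Ω} (hμ : μ ∈ ca 𝓟) (f : MeasFun Ω) :
    integralL0 (mk 𝓟 f) μ = signedIntegral μ f.1 := by
  have hm : MeasurableSet {ω | (rep (mk 𝓟 f)).1 ω ≠ f.1 ω} :=
    (measurableSet_eq_fun (rep (mk 𝓟 f)).2 f.2).compl
  have h0 := hμ _ hm (mk_eq_iff.1 (mk_rep (mk 𝓟 f)))
  rw [SignedMeasure.totalVariation, Measure.add_apply, add_eq_zero] at h0
  have h1 : (rep (mk 𝓟 f)).1 =ᵐ[μ.toJordanDecomposition.posPart] f.1 := h0.1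
  have h2 : (rep (mk 𝓟 f)).1 =ᵐ[μ.toJordanDecomposition.negPart] f.1 := h0.2
  unfold integralL0 signedIntegral
  rw [integral_congr_ae h1, integral_congr_ae h2]

/-- `𝓨` separates the points of `L^∞_c`. -/
def SeparatesLinfty (𝓟 : Set (ProbabilityMeasure Ω)) (𝓨 : Set (SignedMeasure Ω)) : Prop :=
  ∀ X ∈ Linfty 𝓟, ∀ Z ∈ Linfty 𝓟, X ≠ Z → ∃ μ ∈ 𝓨, integralL0 X μ ≠ integralL0 Z μ

end QuotientSpace

section SubsetsOfL0

variable {𝓟 : Set (ProbabilityMeasure Ω)}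

/-- `C` is solid in `L⁰_c`. -/
def IsSolidInL0 (C : Set (L0 𝓟)) : Prop :=
  ∀ X ∈ C, ∀ Y : L0 𝓟, absL0 Y ≤ absL0 X → Y ∈ C

/-- `C` is solid in the positive cone of `L⁰_c`. -/
def IsSolidInL0Pos (C : Set (L0 𝓟)) : Prop :=
  (∀ X ∈ C, 0 ≤ X) ∧ ∀ X ∈ C, ∀ Y : L0 𝓟, 0 ≤ Y → Y ≤ X → Y ∈ C

/-- `C` is solid: it is solid in `L⁰_c` or solid in the positive cone of `L⁰_c`. -/
def IsSolidL0 (C : Set (L0 𝓟)) : Prop :=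
  IsSolidInL0 C ∨ IsSolidInL0Pos C

/-- The net `X` is order convergent to `Z`. -/
def OrderConverges {I : Type u} [Preorder I] (X : I → L0 𝓟) (Z : L0 𝓟) : Prop :=
  ∃ Y : I → L0 𝓟, Antitone Y ∧ IsGLB (Set.range Y) 0 ∧ ∀ i, absL0 (X i - Z) ≤ Y i

/-- `C` is order closed: it contains the limit of every order convergent net in `C`.
The index sets range over all non-empty directed sets in the universe of `Ω`. -/
def IsOrderClosed (C : Set (L0 𝓟)) : Prop :=
  ∀ (I : Type u) [Preorder I] [IsDirectedOrder I] [Nonempty I] (X : I → L0 𝓟) (Z : L0 𝓟),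
    (∀ i, X i ∈ C) → OrderConverges X Z → Z ∈ C

/-- The map `j_Q : L⁰_c → L⁰_Q`, `[f]_c ↦ [f]_Q`, for `Q ∈ 𝔓_c(Ω)`. -/
def proj (Q : ProbabilityMeasure Ω) (hQ : Q ∈ domProb 𝓟) :
    L0 𝓟 →ₗ[ℝ] L0 ({Q} : Set (ProbabilityMeasure Ω)) :=
  Submodule.mapQ (nullFun 𝓟) (nullFun {Q}) LinearMap.id (fun f hf => isPolar_iff.2 (by
    rintro P rfl
    have hfm : Measurable f.1 := f.2
    have hm : MeasurableSet {ω | 0 < |f.1 ω|} :=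
      measurableSet_lt measurable_const (by fun_prop)
    exact hQ _ hm hf))

theorem proj_mk (Q : ProbabilityMeasure Ω) (hQ : Q ∈ domProb 𝓟) (f : MeasFun Ω) :
    proj Q hQ (mk 𝓟 f) = mk {Q} f := rfl

/-- The set `⋂_{Q ∈ 𝓠} j_Q⁻¹(j_Q(C))`, for `𝓠 ⊆ 𝔓_c(Ω)`. -/
def sensitiveHull (𝓠 : Set (ProbabilityMeasure Ω)) (C : Set (L0 𝓟)) : Set (L0 𝓟) :=
  ⋂ (Q : ProbabilityMeasure Ω) (hQ : Q ∈ domProb 𝓟) (_ : Q ∈ 𝓠), proj Q hQ ⁻¹' (proj Q hQ '' C)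

/-- `C` is `𝓟`-sensitive. -/
def IsSensitive (C : Set (L0 𝓟)) : Prop :=
  C = sensitiveHull (domProb 𝓟) C

/-- `𝓠` is a reduction set for `C`. -/
def IsReductionSet (𝓠 : Set (ProbabilityMeasure Ω)) (C : Set (L0 𝓟)) : Prop :=
  𝓠 ⊆ domProb 𝓟 ∧ 𝓠.Nonempty ∧ C = sensitiveHull 𝓠 C

end SubsetsOfL0

end QuasiSure

namespace QuasiSure

universe v

variable {Ω : Type v} [MeasurableSpace Ω] {𝓟 : Set (ProbabilityMeasure Ω)}

/-! Let `X` lie in the hull over the probability measures in `𝓨`, and let `Q` be one of them, with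
order support `S`. Then `X` agrees `Q`-a.s. with an element of `C`. Since `Q`-null subsets of `S`
are polar, they agree q.s. on `S`, and solidity puts `X·1_S` into `C`
(`IsSolidL0.indFun_mem_of_proj_mem`).

These supports are directed under union, and by separation they exhaust `Ω` up to polar events
(`exists_supportIndex_not_isPolar`). Hence `|X|·1_{Sᶜ}` decreases to `0`, the net `X·1_S` is order
convergent to `X` (`orderConverges_indFun`), and order closedness gives `X ∈ C`. Sensitivity follows
because the hull over more measures is smaller. -/

theorem totalVariation_toSignedMeasure (μ : Measure Ω) [IsFiniteMeasure μ] :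
    μ.toSignedMeasure.totalVariation = μ := by
  have h : μ.toSignedMeasure.toJordanDecomposition =
      ⟨μ, 0, Measure.MutuallySingular.zero_right⟩ :=
    SignedMeasure.toJordanDecomposition_eq (by
      simp [JordanDecomposition.toSignedMeasure])
  simp [SignedMeasure.totalVariation, h]

/-! ### Order supports and normalization -/

/-- `S` is an order support of the measure `μ`. -/
def IsOrderSupport (𝓟 : Set (ProbabilityMeasure Ω)) (μ : Measure Ω) (S : Set Ω) : Prop :=
  MeasurableSet S ∧ μ Sᶜ = 0 ∧
    ∀ N : Set Ω, MeasurableSet N → μ (N ∩ S) = 0 → IsPolar 𝓟 (N ∩ S)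

/-- A null set of the sum is null for both summands, so its parts in `S` and in `T` are polar. -/
theorem IsOrderSupport.add {μ ν : Measure Ω} {S T : Set Ω} (hS : IsOrderSupport 𝓟 μ S)
    (hT : IsOrderSupport 𝓟 ν T) : IsOrderSupport 𝓟 (μ + ν) (S ∪ T) := by
  refine ⟨hS.1.union hT.1, ?_, fun N hN h => ?_⟩
  · rw [Measure.add_apply, add_eq_zero]
    exact ⟨measure_mono_null (Set.compl_subset_compl.2 Set.subset_union_left) hS.2.1,
      measure_mono_null (Set.compl_subset_compl.2 Set.subset_union_right) hT.2.1⟩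
  · rw [Measure.add_apply, add_eq_zero] at h
    rw [Set.inter_union_distrib_left] at h ⊢
    exact (hS.2.2 N hN (measure_mono_null Set.subset_union_left h.1)).union
      (hT.2.2 N hN (measure_mono_null Set.subset_union_right h.2))

/-- Order supports depend only on the null sets, hence survive normalization. -/
theorem IsOrderSupport.congr {μ ν : Measure Ω} {S : Set Ω} (hS : IsOrderSupport 𝓟 μ S)
    (h : ∀ A, ν A = 0 ↔ μ A = 0) : IsOrderSupport 𝓟 ν S :=
  ⟨hS.1, (h _).2 hS.2.1, fun N hN hNS => hS.2.2 N hN ((h _).1 hNS)⟩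

/-- A non-zero finite measure in a subspace of signed measures can be normalized within it. -/
theorem exists_probabilityMeasure_mem (𝓨 : Submodule ℝ (SignedMeasure Ω)) (μ : Measure Ω)
    [IsFiniteMeasure μ] (hμ : μ ≠ 0) (hmem : μ.toSignedMeasure ∈ 𝓨) :
    ∃ Q : ProbabilityMeasure Ω, (Q : Measure Ω).toSignedMeasure ∈ 𝓨 ∧
      ∀ A, (Q : Measure Ω) A = 0 ↔ μ A = 0 := by
  have h0 : μ Set.univ ≠ 0 := by simpa using hμ
  have hfin : μ Set.univ ≠ ⊤ := measure_ne_top μ _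
  set r : NNReal := ((μ Set.univ)⁻¹).toNNReal with hr
  have hrc : (r : ENNReal) = (μ Set.univ)⁻¹ := ENNReal.coe_toNNReal (by simpa using h0)
  have hr0 : r ≠ 0 := by
    intro h
    rw [h, ENNReal.coe_zero, eq_comm, ENNReal.inv_eq_zero] at hrc
    exact hfin hrc
  have happ : ∀ A, (r • μ) A = r * μ A := fun A => rfl
  have hprob : IsProbabilityMeasure (r • μ) :=
    ⟨by rw [happ, hrc, ENNReal.inv_mul_cancel h0 hfin]⟩
  refine ⟨⟨r • μ, hprob⟩, ?_, fun A => ?_⟩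
  · have h : (r • μ).toSignedMeasure = (r : ℝ) • μ.toSignedMeasure :=
      Measure.toSignedMeasure_smul μ r
    change (r • μ).toSignedMeasure ∈ 𝓨
    rw [h]
    exact 𝓨.smul_mem _ hmem
  · change (r • μ) A = 0 ↔ μ A = 0
    simp [happ, hr0]

/-! ### Restriction to events and solid sets -/

/-- The product of a measurable function with the indicator of a measurable set. -/
noncomputable def indFun (S : Set Ω) (hS : MeasurableSet S) (f : MeasFun Ω) : MeasFun Ω :=
  ⟨S.indicator f.1, Measurable.indicator f.2 hS⟩

theorem indFun_apply_mem {S : Set Ω} {hS : MeasurableSet S} {f : MeasFun Ω} {ω : Ω}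
    (h : ω ∈ S) : (indFun S hS f).1 ω = f.1 ω :=
  Set.indicator_of_mem h _

theorem indFun_apply_notMem {S : Set Ω} {hS : MeasurableSet S} {f : MeasFun Ω} {ω : Ω}
    (h : ω ∉ S) : (indFun S hS f).1 ω = 0 :=
  Set.indicator_of_notMem h _

theorem mk_le_mk_of_le {f g : MeasFun Ω} (h : ∀ ω, f.1 ω ≤ g.1 ω) : mk 𝓟 f ≤ mk 𝓟 g :=
  mk_le_mk.2 ((isPolar_empty 𝓟).mono fun ω hω => absurd (h ω) (not_le.2 hω))

/-- Solid sets are stable under multiplication with indicators. -/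
theorem IsSolidL0.indFun_mem {C : Set (L0 𝓟)} (hC : IsSolidL0 C) {f : MeasFun Ω}
    (hf : mk 𝓟 f ∈ C) (S : Set Ω) (hS : MeasurableSet S) : mk 𝓟 (indFun S hS f) ∈ C := by
  rcases hC with hC | ⟨hpos, hC⟩
  · refine hC _ hf _ ?_
    rw [absL0_mk, absL0_mk]
    refine mk_le_mk_of_le fun ω => ?_
    change |(indFun S hS f).1 ω| ≤ |f.1 ω|
    by_cases h : ω ∈ S
    · rw [indFun_apply_mem h]
    · rw [indFun_apply_notMem h, abs_zero]
      exact abs_nonneg _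
  -- Off the polar event `{f < 0}`, `0 ≤ f·1_S ≤ f` holds pointwise.
  · have h0 : IsPolar 𝓟 {ω | f.1 ω < 0} := (mk_le_mk (f := 0) (g := f)).1 (hpos _ hf)
    refine hC _ hf _ ((mk_le_mk (f := 0) (g := indFun S hS f)).2 (h0.mono fun ω hω => ?_))
      (mk_le_mk.2 (h0.mono fun ω hω => ?_))
    · by_cases h : ω ∈ S
      · change (indFun S hS f).1 ω < 0 at hω
        rwa [indFun_apply_mem h] at hω
      · change (indFun S hS f).1 ω < 0 at hω
        rw [indFun_apply_notMem h] at hω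
        exact absurd hω (lt_irrefl _)
    · by_cases h : ω ∈ S
      · change f.1 ω < (indFun S hS f).1 ω at hω
        rw [indFun_apply_mem h] at hω
        exact absurd hω (lt_irrefl _)
      · change f.1 ω < (indFun S hS f).1 ω at hω
        rwa [indFun_apply_notMem h] at hω

theorem subset_sensitiveHull (𝓠 : Set (ProbabilityMeasure Ω)) (C : Set (L0 𝓟)) :
    C ⊆ sensitiveHull 𝓠 C := fun X hX => by
  simp only [sensitiveHull, Set.mem_iInter]
  exact fun Q hQ _ => ⟨X, hX, rfl⟩

theorem sensitiveHull_anti {𝓠 𝓡 : Set (ProbabilityMeasure Ω)} (h : 𝓠 ⊆ 𝓡) (C : Set (L0 𝓟)) :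
    sensitiveHull 𝓡 C ⊆ sensitiveHull 𝓠 C := fun X hX => by
  simp only [sensitiveHull, Set.mem_iInter] at hX ⊢
  exact fun Q hQ hQ' => hX Q hQ (h hQ')

/-- If `[f]_c` agrees `Q`-a.s. with an element of a solid set `C`, then its restriction to the
order support of `Q` belongs to `C`. -/
theorem IsSolidL0.indFun_mem_of_proj_mem {C : Set (L0 𝓟)} (hC : IsSolidL0 C) {f : MeasFun Ω}
    {Q : ProbabilityMeasure Ω} (hQ : Q ∈ domProb 𝓟)
    (hf : proj Q hQ (mk 𝓟 f) ∈ proj Q hQ '' C) {S : Set Ω}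
    (hS : IsOrderSupport 𝓟 (Q : Measure Ω) S) : mk 𝓟 (indFun S hS.1 f) ∈ C := by
  obtain ⟨Y, hY, hYf⟩ := hf
  obtain ⟨g, rfl⟩ := mk_surjective Y
  rw [proj_mk, proj_mk, mk_eq_iff, isPolar_iff] at hYf
  -- The support property upgrades `Q`-a.s. equality to q.s. equality on `S`.
  have hp : IsPolar 𝓟 ({ω | g.1 ω ≠ f.1 ω} ∩ S) :=
    hS.2.2 _ (measurableSet_eq_fun g.2 f.2).compl
      (measure_mono_null Set.inter_subset_left (hYf Q rfl))
  have heq : mk 𝓟 (indFun S hS.1 f) = mk 𝓟 (indFun S hS.1 g) := by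
    refine mk_eq_iff.2 (hp.mono fun ω hω => ?_)
    by_cases h : ω ∈ S
    · refine ⟨fun h' => hω ?_, h⟩
      rw [indFun_apply_mem h, indFun_apply_mem h, h']
    · exact absurd (by rw [indFun_apply_notMem h, indFun_apply_notMem h]) hω
  rw [heq]
  exact hC.indFun_mem hY S hS.1

theorem indFun_const_mem_Linfty (A : Set Ω) (hA : MeasurableSet A) :
    mk 𝓟 (indFun A hA (constFun 1)) ∈ Linfty 𝓟 := by
  refine ⟨1, one_pos, ?_⟩
  rw [absL0_mk]
  refine mk_le_mk_of_le fun ω => ?_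
  change |(indFun A hA (constFun 1)).1 ω| ≤ 1
  by_cases h : ω ∈ A
  · rw [indFun_apply_mem h]
    exact abs_one.le
  · rw [indFun_apply_notMem h, abs_zero]
    exact zero_le_one

/-! ### Separation and the net of supports -/

/-- A non-polar event is charged by an element of any separating set of measures in `ca_c`. -/
theorem SeparatesLinfty.exists_totalVariation_ne_zero {𝓨 : Set (SignedMeasure Ω)}
    (hsep : SeparatesLinfty 𝓟 𝓨) (hca : 𝓨 ⊆ ca 𝓟) {A : Set Ω} (hA : MeasurableSet A)
    (hpol : ¬ IsPolar 𝓟 A) : ∃ μ ∈ 𝓨, μ.totalVariation A ≠ 0 := by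
  -- The indicator of `∅` plays the role of `0`, to be separated from the indicator of `A`.
  have h0 : mk 𝓟 (indFun ∅ MeasurableSet.empty (constFun 1)) ∈ Linfty 𝓟 :=
    indFun_const_mem_Linfty ∅ MeasurableSet.empty
  have hne : mk 𝓟 (indFun A hA (constFun 1)) ≠
      mk 𝓟 (indFun ∅ MeasurableSet.empty (constFun 1)) := fun h => by
    refine hpol ((mk_eq_iff.1 h).mono fun ω hω => ?_)
    rw [Set.mem_ofPred_eq, indFun_apply_mem hω, indFun_apply_notMem (Set.notMem_empty ω)]
    exact one_ne_zero
  obtain ⟨μ, hμ, hint⟩ := hsep _ (indFun_const_mem_Linfty A hA) _ h0 hne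
  refine ⟨μ, hμ, fun hzero => hint ?_⟩
  rw [integralL0_mk (hca hμ), integralL0_mk (hca hμ)]
  rw [SignedMeasure.totalVariation, Measure.add_apply, add_eq_zero] at hzero
  have key : ∀ ν : Measure Ω, ν A = 0 → ∫ ω, (indFun A hA (constFun 1)).1 ω ∂ν =
      ∫ ω, (indFun ∅ MeasurableSet.empty (constFun 1)).1 ω ∂ν := fun ν hν => by
    refine integral_congr_ae (measure_mono_null (fun ω hω => ?_) hν)
    by_contra h
    exact hω (by
      rw [Set.mem_ofPred_eq, indFun_apply_notMem h, indFun_apply_notMem (Set.notMem_empty ω)])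
  unfold signedIntegral
  rw [key _ hzero.1, key _ hzero.2]

/-- The order supports of the non-zero positive measures in `𝓨`, ordered by inclusion. -/
abbrev SupportIndex (𝓟 : Set (ProbabilityMeasure Ω)) (𝓨 : Submodule ℝ (SignedMeasure Ω)) :
    Type v :=
  {S : Set Ω // ∃ μ : Measure Ω, ∃ _ : IsFiniteMeasure μ,
    μ ≠ 0 ∧ μ.toSignedMeasure ∈ 𝓨 ∧ IsOrderSupport 𝓟 μ S}

theorem SupportIndex.measurableSet {𝓨 : Submodule ℝ (SignedMeasure Ω)}
    (S : SupportIndex 𝓟 𝓨) : MeasurableSet S.1 := by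
  obtain ⟨_, _, _, _, h⟩ := S.2
  exact h.1

/-- An upper bound of two supports is their union, which supports the sum of the measures;
positivity prevents cancellation. -/
instance (𝓨 : Submodule ℝ (SignedMeasure Ω)) : IsDirectedOrder (SupportIndex 𝓟 𝓨) where
  directed := by
    rintro ⟨S, μ, hμ, hμ0, hμY, hμS⟩ ⟨T, ν, hν, _, hνY, hνT⟩
    refine ⟨⟨S ∪ T, μ + ν, inferInstance, fun h => hμ0 ?_, ?_, hμS.add hνT⟩,
      Set.subset_union_left, Set.subset_union_right⟩
    · rw [← Measure.measure_univ_eq_zero] at h ⊢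
      rw [Measure.add_apply, add_eq_zero] at h
      exact h.1
    · rw [Measure.toSignedMeasure_add]
      exact 𝓨.add_mem hμY hνY

/-- Every non-polar event has a non-polar part in the order support of some measure in `𝓨`. -/
theorem exists_supportIndex_not_isPolar {𝓨 : Submodule ℝ (SignedMeasure Ω)}
    (hsca : (𝓨 : Set (SignedMeasure Ω)) ⊆ sca 𝓟)
    (hsep : SeparatesLinfty 𝓟 (𝓨 : Set (SignedMeasure Ω)))
    (habs : ∀ μ ∈ 𝓨, μ.totalVariation.toSignedMeasure ∈ 𝓨) {A : Set Ω} (hA : MeasurableSet A)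
    (hpol : ¬ IsPolar 𝓟 A) : ∃ S : SupportIndex 𝓟 𝓨, ¬ IsPolar 𝓟 (A ∩ S.1) := by
  obtain ⟨μ, hμ, hμA⟩ :=
    hsep.exists_totalVariation_ne_zero (fun ν hν => (hsca hν).1) hA hpol
  obtain ⟨S, hS⟩ := (hsca hμ).2
  refine ⟨⟨S, μ.totalVariation, inferInstance, fun h => hμA (by simp [h]), habs μ hμ, hS⟩,
    fun hAS => hμA ?_⟩
  -- If `A ∩ S` were polar, domination would make it `|μ|`-null; as `Sᶜ` is null too, `|μ|(A) = 0`.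
  have h1 := (hsca hμ).1 _ (hA.inter hS.1) hAS
  refine measure_mono_null (fun ω hω => ?_) (measure_union_null h1 hS.2.1)
  by_cases h : ω ∈ S
  · exact Or.inl ⟨hω, h⟩
  · exact Or.inr h

/-- The restrictions of `[f]_c` to the order supports of measures in `𝓨` are order convergent
to `[f]_c`. -/
theorem orderConverges_indFun {𝓨 : Submodule ℝ (SignedMeasure Ω)}
    (hsca : (𝓨 : Set (SignedMeasure Ω)) ⊆ sca 𝓟)
    (hsep : SeparatesLinfty 𝓟 (𝓨 : Set (SignedMeasure Ω)))
    (habs : ∀ μ ∈ 𝓨, μ.totalVariation.toSignedMeasure ∈ 𝓨) (f : MeasFun Ω) :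
    OrderConverges (fun S : SupportIndex 𝓟 𝓨 => mk 𝓟 (indFun S.1 S.measurableSet f))
      (mk 𝓟 f) := by
  refine ⟨fun S => mk 𝓟 (indFun S.1ᶜ S.measurableSet.compl (absFun f)), fun S T hST => ?_,
    ⟨?_, fun Z hZ => ?_⟩, fun S => ?_⟩
  · refine mk_le_mk_of_le fun ω => ?_
    exact Set.indicator_le_indicator_of_subset (Set.compl_subset_compl.2 hST)
      (fun ω => abs_nonneg _) ω
  · rintro _ ⟨S, rfl⟩
    exact mk_le_mk_of_le (f := 0) fun ω => Set.indicator_nonneg (fun ω _ => abs_nonneg _) ω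
  -- A lower bound `g` that is positive on a non-polar event is so on a non-polar part of some `S`,
  -- where the dominating function `|f|·1_{Sᶜ}` vanishes.
  · obtain ⟨g, rfl⟩ := mk_surjective Z
    by_contra hcon
    have hpol : ¬ IsPolar 𝓟 {ω | 0 < g.1 ω} := fun h => hcon ((mk_le_mk (g := 0)).2 h)
    obtain ⟨S, hS⟩ := exists_supportIndex_not_isPolar hsca hsep habs
      (measurableSet_lt measurable_const g.2) hpol
    refine hS ((mk_le_mk.1 (hZ ⟨S, rfl⟩)).mono fun ω hω => ?_)
    rw [Set.mem_ofPred_eq, indFun_apply_notMem (Set.notMem_compl_iff.2 hω.2)]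
    exact hω.1
  · change absL0 (mk 𝓟 (indFun S.1 S.measurableSet f - f)) ≤ _
    rw [absL0_mk]
    refine mk_le_mk_of_le fun ω => ?_
    change |(indFun S.1 S.measurableSet f).1 ω - f.1 ω| ≤ _
    by_cases h : ω ∈ S.1
    · rw [indFun_apply_mem h, indFun_apply_notMem (Set.notMem_compl_iff.2 h), sub_self, abs_zero]
    · rw [indFun_apply_notMem h, indFun_apply_mem (Set.mem_compl h), zero_sub, abs_neg]
      rfl

/-- `Ω` itself is not polar because `𝓟` is non-empty, so some support meets it in a non-polar set.
-/
theorem nonempty_supportIndex (h𝓟 : 𝓟.Nonempty) {𝓨 : Submodule ℝ (SignedMeasure Ω)}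
    (hsca : (𝓨 : Set (SignedMeasure Ω)) ⊆ sca 𝓟)
    (hsep : SeparatesLinfty 𝓟 (𝓨 : Set (SignedMeasure Ω)))
    (habs : ∀ μ ∈ 𝓨, μ.totalVariation.toSignedMeasure ∈ 𝓨) :
    Nonempty (SupportIndex 𝓟 𝓨) := by
  obtain ⟨P, hP⟩ := h𝓟
  have h : ¬ IsPolar 𝓟 Set.univ := fun h =>
    IsProbabilityMeasure.ne_zero (P : Measure Ω)
      (Measure.measure_univ_eq_zero.1 (isPolar_iff.1 h P hP))
  obtain ⟨S, -⟩ := exists_supportIndex_not_isPolar hsca hsep habs MeasurableSet.univ h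
  exact ⟨S⟩

theorem SupportIndex.exists_probabilityMeasure {𝓨 : Submodule ℝ (SignedMeasure Ω)}
    (hsca : (𝓨 : Set (SignedMeasure Ω)) ⊆ sca 𝓟) (S : SupportIndex 𝓟 𝓨) :
    ∃ Q : ProbabilityMeasure Ω, Q ∈ domProb 𝓟 ∧ (Q : Measure Ω).toSignedMeasure ∈ 𝓨 ∧
      IsOrderSupport 𝓟 (Q : Measure Ω) S.1 := by
  obtain ⟨μ, _, hμ0, hμ, hS⟩ := S.2
  obtain ⟨Q, hQ, hnull⟩ := exists_probabilityMeasure_mem 𝓨 μ hμ0 hμ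
  refine ⟨Q, ?_, hQ, hS.congr hnull⟩
  -- A positive measure is its own total variation, so membership in `ca` is domination of `Q`.
  have h : MeasureDominated (Q : Measure Ω).toSignedMeasure.totalVariation 𝓟 := (hsca hQ).1
  rwa [totalVariation_toSignedMeasure] at h


/-! ### Reduction to the measures in `𝓨` -/

/-- Solid order closed sets are determined by the supported probability measures in `𝓨`. -/
theorem sensitiveHull_subset {𝓨 : Submodule ℝ (SignedMeasure Ω)}
    (hsca : (𝓨 : Set (SignedMeasure Ω)) ⊆ sca 𝓟)
    (hsep : SeparatesLinfty 𝓟 (𝓨 : Set (SignedMeasure Ω)))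
    (habs : ∀ μ ∈ 𝓨, μ.totalVariation.toSignedMeasure ∈ 𝓨)
    (hne : Nonempty (SupportIndex 𝓟 𝓨)) {C : Set (L0 𝓟)} (hsolid : IsSolidL0 C)
    (hclosed : IsOrderClosed C) :
    sensitiveHull (domProb 𝓟 ∩ {Q | (Q : Measure Ω).toSignedMeasure ∈ 𝓨}) C ⊆ C := by
  intro X hX
  obtain ⟨f, rfl⟩ := mk_surjective X
  have hmem : ∀ S : SupportIndex 𝓟 𝓨, mk 𝓟 (indFun S.1 S.measurableSet f) ∈ C := fun S => by
    obtain ⟨Q, hQ, hQY, hQS⟩ := S.exists_probabilityMeasure hsca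
    simp only [sensitiveHull, Set.mem_iInter, Set.mem_preimage] at hX
    exact hsolid.indFun_mem_of_proj_mem hQ (hX Q hQ ⟨hQ, hQY⟩) hQS
  -- The index type consists of subsets of `Ω`, so it lies in the universe that `IsOrderClosed`
  -- requires.
  exact hclosed _ _ _ hmem (orderConverges_indFun hsca hsep habs f)

theorem nonempty_domProb_inter (h𝓟 : 𝓟.Nonempty) {𝓨 : Submodule ℝ (SignedMeasure Ω)}
    (hsca : (𝓨 : Set (SignedMeasure Ω)) ⊆ sca 𝓟)
    (hsep : SeparatesLinfty 𝓟 (𝓨 : Set (SignedMeasure Ω)))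
    (habs : ∀ μ ∈ 𝓨, μ.totalVariation.toSignedMeasure ∈ 𝓨) :
    (domProb 𝓟 ∩ {Q | (Q : Measure Ω).toSignedMeasure ∈ 𝓨}).Nonempty := by
  obtain ⟨S⟩ := nonempty_supportIndex h𝓟 hsca hsep habs
  obtain ⟨Q, hQ, hQY, -⟩ := S.exists_probabilityMeasure hsca
  exact ⟨Q, hQ, hQY⟩

end QuasiSure

theorem mainTheorem8 {Ω : Type*} [MeasurableSpace Ω]
    (𝓟 : Set (MeasureTheory.ProbabilityMeasure Ω)) (h𝓟 : 𝓟.Nonempty)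
    (hS : QuasiSure.IsClassS 𝓟)
    (𝓨 : Submodule ℝ (MeasureTheory.SignedMeasure Ω))
    (h𝓨sca : (𝓨 : Set (MeasureTheory.SignedMeasure Ω)) ⊆ QuasiSure.sca 𝓟)
    (h𝓨sep : QuasiSure.SeparatesLinfty 𝓟 (𝓨 : Set (MeasureTheory.SignedMeasure Ω)))
    (h𝓨abs : ∀ μ ∈ 𝓨, μ.totalVariation.toSignedMeasure ∈ 𝓨)
    (C : Set (QuasiSure.L0 𝓟)) (hconv : Convex ℝ C) (hsolid : QuasiSure.IsSolidL0 C)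
    (hclosed : QuasiSure.IsOrderClosed C) :
    QuasiSure.IsSensitive C ∧
      QuasiSure.IsReductionSet
        (QuasiSure.domProb 𝓟 ∩
          {Q | (Q : MeasureTheory.Measure Ω).toSignedMeasure ∈ 𝓨}) C := by
  have hsub := QuasiSure.sensitiveHull_subset h𝓨sca h𝓨sep h𝓨abs
    (QuasiSure.nonempty_supportIndex h𝓟 h𝓨sca h𝓨sep h𝓨abs) hsolid hclosed
  exact ⟨(QuasiSure.subset_sensitiveHull _ C).antisymm
      ((QuasiSure.sensitiveHull_anti Set.inter_subset_left C).trans hsub),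
    Set.inter_subset_left, QuasiSure.nonempty_domProb_inter h𝓟 h𝓨sca h𝓨sep h𝓨abs,
    (QuasiSure.subset_sensitiveHull _ C).antisymm hsub⟩
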